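/- Let $2\le k\le m$ be integers, write $[m]=\{1,\dots,m\}$, and let $a_{pq}$ ($1\le p,q\le m$) be commuting variables. Power series are taken with coefficients in $\mathbb Z$, or more generally in any commutative ring $R$ (with any Hausdorff topology, formal power series carrying the topology of coefficientwise convergence). For a sequence $\mathbf i=(i_1,\dots,i_\ell)\in[m]^\ell$ let $\mathrm{inv}(\mathbf i)=|\{(s,t): s<t,\ i_s>i_t\}|$. The sequence $\mathbf i$ is *admissible* if no $k$ consecutive entries of it are strictly decreasing; $\Lambda(m,k,\ell)$ is the set of admissible sequences in $[m]^\ell$. For $\mathbf i,\mathbf i'\in[m]^\ell$ write $\mathbf i\to\mathbf i'$ (a *$k$-reversion*) if $\mathbf i\ne\mathbf i'$ and $\mathbf i$ is obtained from $\mathbf i'$ by permuting the $k$ entries of the leftmost run $i'_s>i'_{s+1}>\dots>i'_{s+k-1}$ of $k$ consecutive strictly decreasing entries of $\mathbf i'$ (the one with $s$ smallest). A *reversion path* $\gamma$ from $\mathbf i$ to $\mathbf j$ is a finite sequence of $k$-reversions $\mathbf i\to\mathbf i'\to\dots\to\mathbf j$, and $|\gamma|\ge 0$ is the number of its steps (if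 $\mathbf i=\mathbf j$, the path without steps is allowed). Put $$c_{\mathbf i,\mathbf j}=\sum_{\gamma}(-1)^{\mathrm{inv}(\mathbf j)-\mathrm{inv}(\mathbf i)-|\gamma|},$$ the sum being over the finitely many reversion paths $\gamma$ from $\mathbf i$ to $\mathbf j$, and $a_{\mathbf i\mathbf j}=a_{i_1j_1}\cdots a_{i_\ell j_\ell}$. A *partial permutation* $\omega$ of $[m]$ is a subset $J\subseteq[m]$ together with a permutation $\omega$ of $J$; $\Sigma_m(r)$ is the set of those with $|J|=r$. Let $\mathrm{inv}(\omega)=|\{(s,t)\in J^2: s<t,\ \omega(s)>\omega(t)\}|$ and $a_\omega=\prod_{j\in J}a_{j\,\omega(j)}$ (so $a_\omega=1$ if $J=\varnothing$). Let $\alpha(r)=r-(r\bmod k)$. Then the infinite sum below converges as a formal power series in the $a_{pq}$, and $$\left[1+\sum_{\ell=1}^\infty\ \sum_{\mathbf i\in\Lambda(m,k,\ell)}\ \sum_{\mathbf j\in[m]^\ell}c_{\mathbf i,\mathbf j}\,a_{\mathbf i\mathbf j}\right]\cdot\left[\sum_{\substack{0\le r\le m\\ r\equiv 0,1\ (\mathrm{mod}\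 k)}}(-1)^{\alpha(r)}\sum_{\omega\in\Sigma_m(r)}(-1)^{r+\mathrm{inv}(\omega)}a_\omega\right]=1 .$$ -/

import Mathlib

open scoped MvPowerSeries.WithPiTopology

namespace KReversion

/-- The number of inversions of a sequence `i` of length `ℓ` with entries in `[m]`. -/
def inv {ℓ m : ℕ} (i : Fin ℓ → Fin m) : ℕ :=
  (Finset.univ.filter fun p : Fin ℓ × Fin ℓ => p.1 < p.2 ∧ i p.2 < i p.1).card

/-- The positions `s, s + 1, …, s + k - 1` inside a sequence of length `ℓ`. -/
def window (ℓ k s : ℕ) : Set (Fin ℓ) := {p | s ≤ (p : ℕ) ∧ (p : ℕ) < s + k}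

/-- The `k` consecutive entries of `i` starting at position `s` exist and are strictly
decreasing. -/
def DecreasingAt {ℓ m : ℕ} (k : ℕ) (i : Fin ℓ → Fin m) (s : ℕ) : Prop :=
  s + k ≤ ℓ ∧ StrictAntiOn i (window ℓ k s)

/-- A sequence is admissible if no `k` consecutive entries are strictly decreasing. -/
def Admissible {ℓ m : ℕ} (k : ℕ) (i : Fin ℓ → Fin m) : Prop :=
  ∀ s, ¬ DecreasingAt k i s

/-- The `k`-reversion `i → i'`: the sequence `i` is different from `i'` and is obtained from it
by permuting the entries of the leftmost decreasing run of `k` consecutive entries of `i'`. -/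
def Reversion {ℓ m : ℕ} (k : ℕ) (i i' : Fin ℓ → Fin m) : Prop :=
  i ≠ i' ∧ ∃ s, IsLeast {s | DecreasingAt k i' s} s ∧
    ∃ σ : Equiv.Perm (Fin ℓ), (∀ p, p ∉ window ℓ k s → σ p = p) ∧ i = i' ∘ σ

/-- Reversion paths `i → i' → i'' → … → j`, including the path without steps. -/
inductive ReversionPath (k : ℕ) {ℓ m : ℕ} (i : Fin ℓ → Fin m) : (Fin ℓ → Fin m) → Type
  | nil : ReversionPath k i i
  | snoc {j j' : Fin ℓ → Fin m} (γ : ReversionPath k i j) (h : Reversion k j j') :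
      ReversionPath k i j'

/-- The number of `k`-reversions in a path. -/
def ReversionPath.length {k ℓ m : ℕ} {i : Fin ℓ → Fin m} :
    {j : Fin ℓ → Fin m} → ReversionPath k i j → ℕ
  | _, .nil => 0
  | _, .snoc γ _ => γ.length + 1

/-- Every `k`-reversion increases the number of inversions. -/
theorem Reversion.inv_lt {k ℓ m : ℕ} {i i' : Fin ℓ → Fin m} (h : Reversion k i i') :
    inv i < inv i' := by
  obtain ⟨hne, s, ⟨⟨-, hanti⟩, -⟩, σ, hσ, rfl⟩ := h
  have hW : ∀ p, p ∈ window ℓ k s → σ p ∈ window ℓ k s := by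
    intro p hp
    by_contra hc
    have h1 := σ.injective (hσ _ hc)
    exact hc (by rw [h1]; exact hp)
  have key : ∀ p q : Fin ℓ, p < q → σ p < σ q ∨
      (σ q < σ p ∧ σ p ∈ window ℓ k s ∧ σ q ∈ window ℓ k s) := by
    intro p q hpq
    have hpW := hW p
    have hqW := hW q
    have hp := hσ p
    have hq := hσ q
    have hpq' : (p : ℕ) < q := hpq
    rcases lt_trichotomy (σ p) (σ q) with hlt | heq | hgt
    · exact Or.inl hlt
    · exact absurd (σ.injective heq) hpq.ne
    · right
      by_cases h1 : p ∈ window ℓ k s <;> by_cases h2 : q ∈ window ℓ k s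
      · exact ⟨hgt, hpW h1, hqW h2⟩
      · exfalso
        have a := hpW h1
        rw [hq h2] at hgt
        have : (q : ℕ) < σ p := hgt
        simp only [window, Set.mem_ofPred_eq] at *
        omega
      · exfalso
        have a := hqW h2
        rw [hp h1] at hgt
        have : (σ q : ℕ) < p := hgt
        simp only [window, Set.mem_ofPred_eq] at *
        omega
      · exfalso
        rw [hp h1, hq h2] at hgt
        exact absurd hgt hpq.asymm
  let f : Fin ℓ × Fin ℓ → Fin ℓ × Fin ℓ := fun p =>
    if σ p.1 < σ p.2 then (σ p.1, σ p.2) else (σ p.2, σ p.1)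
  have hlt : ∃ p q : Fin ℓ, p < q ∧ σ q < σ p := by
    by_contra hc
    push Not at hc
    apply hne
    have hmono : StrictMono σ := fun p q hpq =>
      lt_of_le_of_ne (hc p q hpq) fun e => hpq.ne (σ.injective e)
    have : (σ : Fin ℓ → Fin ℓ) = id := by
      have h1 := Subsingleton.elim
        (StrictMono.orderIsoOfSurjective σ hmono σ.surjective) (OrderIso.refl (Fin ℓ))
      funext x
      exact DFunLike.congr_fun h1 x
    rw [this]
    rfl
  have hinj : Set.InjOn f {p | p.1 < p.2} := by
    rintro ⟨a, b⟩ hab ⟨c, d⟩ hcd he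
    simp only [Set.mem_ofPred_eq] at hab hcd
    simp only [f] at he
    split_ifs at he <;> simp only [Prod.mk.injEq, EmbeddingLike.apply_eq_iff_eq] at he <;>
      obtain ⟨rfl, rfl⟩ := he
    · rfl
    · exact absurd hab hcd.asymm
    · exact absurd hab hcd.asymm
    · rfl
  obtain ⟨p, q, hpq, hqp⟩ := hlt
  unfold inv
  rw [← Finset.card_image_of_injOn (f := f) (s := Finset.univ.filter fun p : Fin ℓ × Fin ℓ =>
    p.1 < p.2 ∧ (i' ∘ σ) p.2 < (i' ∘ σ) p.1)
    (hinj.mono (by intro x hx; simp at hx; exact hx.1))]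
  apply Finset.card_lt_card
  rw [Finset.ssubset_iff_of_subset]
  · refine ⟨(σ q, σ p), ?_, ?_⟩
    · rcases key p q hpq with h1 | ⟨_, h1, h2⟩
      · exact absurd h1 hqp.asymm
      · simpa using ⟨hqp, hanti h2 h1 hqp⟩
    · intro hmem
      obtain ⟨⟨a, b⟩, hx, he⟩ := Finset.mem_image.1 hmem
      simp only [Finset.mem_filter, Finset.mem_univ, true_and, Function.comp] at hx
      have he' : f (a, b) = f (p, q) := by
        rw [he]
        simp [f, hqp.asymm]
      have h3 := hinj hx.1 hpq he'
      simp only [Prod.mk.injEq] at h3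
      obtain ⟨rfl, rfl⟩ := h3
      rcases key a b hpq with h1 | ⟨_, h1, h2⟩
      · exact absurd h1 hqp.asymm
      · exact absurd hx.2 (hanti h2 h1 hqp).asymm
  · intro x hx
    obtain ⟨⟨a, b⟩, hy, rfl⟩ := Finset.mem_image.1 hx
    simp only [Finset.mem_filter, Finset.mem_univ, true_and, Function.comp] at hy
    rcases key a b hy.1 with h1 | ⟨h0, h1, h2⟩
    · simp [f, h1, hy.2]
    · simp [f, h0.asymm, h0, hanti h2 h1 h0]

/-- Hence `|γ| ≤ inv j - inv i` for every path `γ` from `i` to `j`. -/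
theorem ReversionPath.inv_add_length_le {k ℓ m : ℕ} {i j : Fin ℓ → Fin m}
    (γ : ReversionPath k i j) : inv i + γ.length ≤ inv j := by
  induction γ with
  | nil => simp [ReversionPath.length]
  | snoc γ h ih =>
    have := h.inv_lt
    simp only [ReversionPath.length]
    omega

/-- There are only finitely many reversion paths between two sequences. -/
theorem ReversionPath.finite {k ℓ m : ℕ} (i : Fin ℓ → Fin m) (n : ℕ) :
    ∀ j : Fin ℓ → Fin m, inv j = n → Finite (ReversionPath k i j) := by
  induction n using Nat.strong_induction_on with
  | _ n ih =>
    intro j hj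
    have hfin : ∀ j' : {j' // Reversion k j' j}, Finite (ReversionPath k i j'.1) :=
      fun j' => ih _ (hj ▸ j'.2.inv_lt) _ rfl
    let F : (PLift (i = j) ⊕ Σ j' : {j' // Reversion k j' j}, ReversionPath k i j'.1) →
        ReversionPath k i j
      | .inl h => h.down ▸ .nil
      | .inr x => .snoc x.2 x.1.2
    apply Finite.of_surjective F
    intro γ
    cases γ with
    | nil => exact ⟨.inl ⟨rfl⟩, rfl⟩
    | snoc γ h => exact ⟨.inr ⟨⟨_, h⟩, γ⟩, rfl⟩

noncomputable instance {k ℓ m : ℕ} (i j : Fin ℓ → Fin m) : Fintype (ReversionPath k i j) :=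
  @Fintype.ofFinite _ (ReversionPath.finite i _ j rfl)

/-- The integers `c_{i,j}`, a signed count of the reversion paths from `i` to `j`. The natural
number subtraction in the exponent never truncates. -/
noncomputable def c {ℓ m : ℕ} (k : ℕ) (i j : Fin ℓ → Fin m) : ℤ :=
  ∑ γ : ReversionPath k i j, (-1) ^ (inv j - inv i - γ.length)

/-- A partial permutation of `[m]`: a subset `J` of `[m]` and a permutation of `J`. -/
abbrev PartialPerm (m : ℕ) : Type := Σ J : Finset (Fin m), Equiv.Perm J

/-- The number of inversions of a partial permutation. -/
def PartialPerm.inv {m : ℕ} (ω : PartialPerm m) : ℕ :=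
  (Finset.univ.filter fun p : ω.1 × ω.1 => p.1 < p.2 ∧ ω.2 p.2 < ω.2 p.1).card

/-- The exponent `α(r) = r - (r mod k)`. -/
def α (k r : ℕ) : ℕ := r - r % k

variable (R : Type*) [CommRing R]

/-- The monomial `a_{ij} = a_{i₁ j₁} ⋯ a_{i_ℓ j_ℓ}` in the commuting variables `a_{p,q}`. -/
noncomputable def aSeq {ℓ m : ℕ} (i j : Fin ℓ → Fin m) : MvPowerSeries (Fin m × Fin m) R :=
  ∏ s, MvPowerSeries.X (i s, j s)

/-- The monomial `a_ω`, the product of `a_{j, ω(j)}` over `j ∈ J`. -/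
noncomputable def aPerm {m : ℕ} (ω : PartialPerm m) : MvPowerSeries (Fin m × Fin m) R :=
  ∏ j : ω.1, MvPowerSeries.X ((j : Fin m), (ω.2 j : Fin m))

open Classical in
/-- The sum of `c_{i,j} a_{ij}` over admissible `i` and arbitrary `j`, both of length `ℓ`. -/
noncomputable def levelSum (m k ℓ : ℕ) : MvPowerSeries (Fin m × Fin m) R :=
  ∑ i : Fin ℓ → Fin m with Admissible k i, ∑ j : Fin ℓ → Fin m, (c k i j : ℤ) • aSeq R i j

end KReversion

/-!
Let `V` be free of rank `m` over a commutative ring `S`. A matrix `a` acts on the tensor algebra of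
`V` and on its quotient `A` by the ideal generated by the `k`-th exterior power, embedded as the
antisymmetric tensors. The words without `k` consecutive decreasing letters form a basis of `A`:
rewriting the leftmost decreasing run of length `k` by means of the defining relation computes
normal forms, and the path count `c k i j` is the coefficient of the admissible word `i` in the
normal form of `j`. Hence the sum over `i` and `j` of length `ℓ` is the trace of `a` on the degree
`ℓ` part of `A` (`levelTrace`), while the second bracket is the alternating sum, over the degrees
`r ≡ 0, 1` modulo `k`, of the traces of `a` on the exterior powers (`minorSum`).

No exactness of a Koszul complex is needed to compare these traces. Confluence of the rewriting
(`altSum_c`) shows that the kernel of the normal form map is stable under the tensor powers of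
matrices (`normalForm_mul_tensorPow_mul_normalForm`), so `levelTrace` is invariant under conjugation
(`levelTrace_mul_comm`), as is `minorSum`. In each degree the claim is a polynomial identity with
integer coefficients in the entries of `a`, so it suffices to prove it for complex matrices, and
therefore for triangular ones (`exists_similar_lowerTriangular`). For a triangular matrix with
diagonal `t`, the traces become the sums of the monomials in `t` given by the admissible words and
by the decreasing words of length `r`. A fixed word contributes the sum of the signs over its
splittings into an admissible prefix and a decreasing suffix, and this sum vanishes
(`sum_splittings_eq_zero`).
-/

namespace KReversion

/-! ### Permuting the entries of a sequence inside a set of positions -/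

open Classical in
/-- The permutations of the positions that move only positions in `S`. -/
noncomputable def permsOn {ℓ : ℕ} (S : Set (Fin ℓ)) : Finset (Equiv.Perm (Fin ℓ)) :=
  Finset.univ.filter fun σ => ∀ p, p ∉ S → σ p = p

theorem mem_permsOn {ℓ : ℕ} {S : Set (Fin ℓ)} {σ : Equiv.Perm (Fin ℓ)} :
    σ ∈ permsOn S ↔ ∀ p, p ∉ S → σ p = p := by
  simp [permsOn]

theorem one_mem_permsOn {ℓ : ℕ} (S : Set (Fin ℓ)) : (1 : Equiv.Perm (Fin ℓ)) ∈ permsOn S := by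
  simp [mem_permsOn]

theorem mul_mem_permsOn {ℓ : ℕ} {S : Set (Fin ℓ)} {σ τ : Equiv.Perm (Fin ℓ)}
    (hσ : σ ∈ permsOn S) (hτ : τ ∈ permsOn S) : σ * τ ∈ permsOn S := by
  rw [mem_permsOn] at *
  intro p hp
  rw [Equiv.Perm.mul_apply, hτ p hp, hσ p hp]

theorem inv_mem_permsOn {ℓ : ℕ} {S : Set (Fin ℓ)} {σ : Equiv.Perm (Fin ℓ)}
    (hσ : σ ∈ permsOn S) : σ⁻¹ ∈ permsOn S := by
  rw [mem_permsOn] at *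
  intro p hp
  rw [Equiv.Perm.inv_eq_iff_eq, hσ p hp]

theorem permsOn_mono {ℓ : ℕ} {S T : Set (Fin ℓ)} (h : S ⊆ T) : permsOn S ⊆ permsOn T := by
  intro σ hσ
  rw [mem_permsOn] at *
  exact fun p hp => hσ p fun hS => hp (h hS)

theorem apply_mem_of_mem_permsOn {ℓ : ℕ} {S : Set (Fin ℓ)} {σ : Equiv.Perm (Fin ℓ)}
    (hσ : σ ∈ permsOn S) {p : Fin ℓ} (hp : p ∈ S) : σ p ∈ S := by
  rw [mem_permsOn] at hσ
  by_contra hc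
  have h1 := σ.injective (hσ _ hc)
  exact hc (by rw [h1]; exact hp)

theorem swap_mem_permsOn {ℓ : ℕ} {S : Set (Fin ℓ)} {p q : Fin ℓ} (hp : p ∈ S) (hq : q ∈ S) :
    Equiv.swap p q ∈ permsOn S := by
  rw [mem_permsOn]
  intro r hr
  exact Equiv.swap_apply_of_ne_of_ne (fun h => hr (h ▸ hp)) (fun h => hr (h ▸ hq))

theorem sum_permsOn_mul_right {ℓ : ℕ} {A : Type*} [AddCommMonoid A] {S : Set (Fin ℓ)}
    {τ : Equiv.Perm (Fin ℓ)} (hτ : τ ∈ permsOn S) (f : Equiv.Perm (Fin ℓ) → A) :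
    ∑ σ ∈ permsOn S, f (σ * τ) = ∑ σ ∈ permsOn S, f σ :=
  Finset.sum_bij' (fun σ _ => σ * τ) (fun σ _ => σ * τ⁻¹)
    (fun _ h => mul_mem_permsOn h hτ) (fun _ h => mul_mem_permsOn h (inv_mem_permsOn hτ))
    (by simp) (by simp) (by simp)

theorem sum_permsOn_mul_left {ℓ : ℕ} {A : Type*} [AddCommMonoid A] {S : Set (Fin ℓ)}
    {τ : Equiv.Perm (Fin ℓ)} (hτ : τ ∈ permsOn S) (f : Equiv.Perm (Fin ℓ) → A) :
    ∑ σ ∈ permsOn S, f (τ * σ) = ∑ σ ∈ permsOn S, f σ :=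
  Finset.sum_bij' (fun σ _ => τ * σ) (fun σ _ => τ⁻¹ * σ)
    (fun _ h => mul_mem_permsOn hτ h) (fun _ h => mul_mem_permsOn (inv_mem_permsOn hτ) h)
    (by simp) (by simp) (by simp)

/-- A permutation that moves only positions of an interval `S` preserves the order of two
positions that are not both in `S`. -/
theorem lt_of_mem_permsOn {ℓ : ℕ} {S : Set (Fin ℓ)} (hS : S.OrdConnected)
    {σ : Equiv.Perm (Fin ℓ)} (hσ : σ ∈ permsOn S) {p q : Fin ℓ} (hpq : p < q)
    (h : ¬ (p ∈ S ∧ q ∈ S)) : σ p < σ q := by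
  have hσ' := mem_permsOn.1 hσ
  by_cases hp : p ∈ S
  · have hq : q ∉ S := fun hq => h ⟨hp, hq⟩
    rw [hσ' q hq]
    by_contra hc
    exact hq (hS.out hp (apply_mem_of_mem_permsOn hσ hp) ⟨hpq.le, not_lt.1 hc⟩)
  · rw [hσ' p hp]
    by_cases hq : q ∈ S
    · by_contra hc
      exact hp (hS.out (apply_mem_of_mem_permsOn hσ hq) hq ⟨not_lt.1 hc, hpq.le⟩)
    · rwa [hσ' q hq]

theorem neg_one_pow_inv {ℓ m : ℕ} (w : Fin ℓ → Fin m) :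
    ∏ q : Fin ℓ, ∏ p ∈ Finset.Iio q, (if w q < w p then -1 else 1 : ℤ) = (-1) ^ inv w := by
  rw [Finset.prod_sigma', Finset.prod_ite, Finset.prod_const, Finset.prod_const_one, mul_one]
  congr 1
  unfold inv
  refine Finset.card_bij' (fun x _ => (x.2, x.1)) (fun x _ => ⟨x.2, x.1⟩) ?_ ?_ ?_ ?_ <;> simp

/-- Permuting entries that are pairwise distinct and occupy an interval of positions changes the
parity of the number of inversions by the sign of the permutation. -/
theorem neg_one_pow_inv_comp {ℓ m : ℕ} {S : Set (Fin ℓ)} (hS : S.OrdConnected)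
    {σ : Equiv.Perm (Fin ℓ)} (hσ : σ ∈ permsOn S) {w : Fin ℓ → Fin m} (hw : Set.InjOn w S) :
    (-1 : ℤ) ^ inv (w ∘ σ) = Equiv.Perm.sign σ * (-1) ^ inv w := by
  -- Ties between equal entries are broken by position, so that the comparison sign is
  -- antisymmetric also for words with repeated entries.
  let f : Fin ℓ → Fin ℓ → ℤ := fun p q =>
    if p = q then 0 else if w p < w q ∨ (w p = w q ∧ p < q) then 1 else -1
  have hf : ∀ p q, f p q = -f q p := by
    intro p q
    simp only [f]
    split_ifs <;> grind
  have key := σ.prod_Iio_comp_eq_sign_mul_prod hf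
  have h1 : ∏ q : Fin ℓ, ∏ p ∈ Finset.Iio q, f p q = (-1) ^ inv w := by
    rw [← neg_one_pow_inv]
    refine Finset.prod_congr rfl fun q _ => Finset.prod_congr rfl fun p hp => ?_
    have hp' : p < q := Finset.mem_Iio.1 hp
    simp only [f, hp'.ne, if_false, hp', and_true]
    split_ifs <;> grind
  have h2 : ∏ q : Fin ℓ, ∏ p ∈ Finset.Iio q, f (σ p) (σ q) = (-1) ^ inv (w ∘ σ) := by
    rw [← neg_one_pow_inv]
    refine Finset.prod_congr rfl fun q _ => Finset.prod_congr rfl fun p hp => ?_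
    have hp' : p < q := Finset.mem_Iio.1 hp
    have hne : σ p ≠ σ q := fun h => hp'.ne (σ.injective h)
    simp only [f, hne, if_false, Function.comp]
    rcases lt_trichotomy (w (σ p)) (w (σ q)) with h | h | h
    · simp [h, h.asymm]
    · have : ¬ (p ∈ S ∧ q ∈ S) := fun hpq => hne (hw (apply_mem_of_mem_permsOn hσ hpq.1)
        (apply_mem_of_mem_permsOn hσ hpq.2) h)
      simp [h, lt_of_mem_permsOn hS hσ hp' this]
    · simp [h, h.asymm, h.ne']
  rw [h1, h2] at key
  simpa using key

/-- Pairwise distinct entries on a set of positions can be sorted decreasingly. -/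
theorem exists_strictAntiOn_comp {ℓ m : ℕ} {S : Set (Fin ℓ)} {w : Fin ℓ → Fin m}
    (hw : Set.InjOn w S) : ∃ τ ∈ permsOn S, StrictAntiOn (w ∘ τ) S := by
  -- The sorting permutation minimizes the sum of position times entry.
  obtain ⟨τ, hτ, hmin⟩ := Finset.exists_min_image (permsOn S)
    (fun σ => ∑ p : Fin ℓ, (p : ℤ) * (w (σ p) : ℤ)) ⟨1, one_mem_permsOn S⟩
  refine ⟨τ, hτ, fun p hp q hq hpq => ?_⟩
  by_contra hc
  have hne : w (τ p) ≠ w (τ q) := fun h => hpq.ne (τ.injective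
    (hw (apply_mem_of_mem_permsOn hτ hp) (apply_mem_of_mem_permsOn hτ hq) h))
  have hlt : w (τ p) < w (τ q) := lt_of_le_of_ne (not_lt.1 hc) hne
  have h := hmin _ (mul_mem_permsOn hτ (swap_mem_permsOn hp hq))
  rw [← sub_nonneg, ← Finset.sum_sub_distrib, Finset.sum_eq_add_of_mem p q (Finset.mem_univ _)
    (Finset.mem_univ _) hpq.ne] at h
  · simp only [Equiv.Perm.mul_apply, Equiv.swap_apply_left, Equiv.swap_apply_right] at h
    have a : (p : ℤ) < q := by exact_mod_cast hpq
    have b : (w (τ p) : ℤ) < w (τ q) := by exact_mod_cast hlt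
    nlinarith
  · rintro r - ⟨h1, h2⟩
    rw [Equiv.Perm.mul_apply, Equiv.swap_apply_of_ne_of_ne h1 h2, sub_self]

/-! ### Windows -/

theorem ordConnected_window (ℓ k s : ℕ) : (window ℓ k s).OrdConnected := by
  refine ⟨fun p hp q hq r hr => ?_⟩
  have h1 : (p : ℕ) ≤ r := hr.1
  have h2 : (r : ℕ) ≤ q := hr.2
  simp only [window, Set.mem_ofPred_eq] at *
  omega

/-- Two overlapping decreasing windows form one decreasing window. -/
theorem strictAntiOn_window_union {ℓ m : ℕ} {w : Fin ℓ → Fin m} {a b s t : ℕ} (hst : s ≤ t)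
    (hts : t < s + a) (h1 : StrictAntiOn w (window ℓ a s))
    (h2 : StrictAntiOn w (window ℓ b t)) : StrictAntiOn w (window ℓ (t + b - s) s) := by
  intro p hp q hq hpq
  have hpq' : (p : ℕ) < q := hpq
  simp only [window, Set.mem_ofPred_eq] at hp hq
  by_cases hq1 : (q : ℕ) < s + a
  · exact h1 (show _ ∧ _ by omega) (show _ ∧ _ by omega) hpq
  · by_cases hp1 : t ≤ (p : ℕ)
    · exact h2 (show _ ∧ _ by omega) (show _ ∧ _ by omega) hpq
    · have hr : t < ℓ := by omega
      have e1 : w ⟨t, hr⟩ < w p := h1 (show _ ∧ _ by omega)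
        (show s ≤ t ∧ t < s + a by omega) (show (p : ℕ) < t by omega)
      have e2 : w q < w ⟨t, hr⟩ := h2 (show t ≤ t ∧ t < t + b by omega)
        (show _ ∧ _ by omega) (show t < (q : ℕ) by omega)
      exact e2.trans e1

theorem window_subset {ℓ a b s t : ℕ} (h1 : t ≤ s) (h2 : s + a ≤ t + b) :
    window ℓ a s ⊆ window ℓ b t := by
  intro p hp
  simp only [window, Set.mem_ofPred_eq] at *
  omega

/-! ### Alternating sums over the rearrangements of a set of entries -/

/-- The alternating sum of `F` over the rearrangements of the entries of `w` at the positions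
in `S`. -/
noncomputable def altSum {ℓ m : ℕ} {A : Type*} [AddCommGroup A] (S : Set (Fin ℓ))
    (F : (Fin ℓ → Fin m) → A) (w : Fin ℓ → Fin m) : A :=
  ∑ σ ∈ permsOn S, (Equiv.Perm.sign σ : ℤ) • F (w ∘ σ)

section

variable {ℓ m : ℕ} {A : Type*} [AddCommGroup A]

theorem sign_mul_self {n : ℕ} (σ : Equiv.Perm (Fin n)) :
    (Equiv.Perm.sign σ : ℤ) * Equiv.Perm.sign σ = 1 := by
  rw [← Units.val_mul, Int.units_mul_self, Units.val_one]

theorem altSum_comp {S : Set (Fin ℓ)} {τ : Equiv.Perm (Fin ℓ)} (hτ : τ ∈ permsOn S)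
    (F : (Fin ℓ → Fin m) → A) (w : Fin ℓ → Fin m) :
    altSum S F (w ∘ τ) = (Equiv.Perm.sign τ : ℤ) • altSum S F w := by
  unfold altSum
  rw [← sum_permsOn_mul_left hτ (fun σ => (Equiv.Perm.sign σ : ℤ) • F (w ∘ σ)), Finset.smul_sum]
  refine Finset.sum_congr rfl fun σ _ => ?_
  rw [smul_smul, Equiv.Perm.sign_mul, Units.val_mul, ← mul_assoc, sign_mul_self, one_mul]
  rfl

theorem sum_altSum_of_subset {S U : Set (Fin ℓ)} (h : S ⊆ U) (F : (Fin ℓ → Fin m) → A)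
    (w : Fin ℓ → Fin m) :
    ∑ ρ ∈ permsOn U, (Equiv.Perm.sign ρ : ℤ) • altSum S F (w ∘ ρ) =
      (permsOn S).card • altSum U F w := by
  simp only [altSum, Finset.smul_sum (s := permsOn S)]
  rw [Finset.sum_comm, ← Finset.sum_const]
  refine Finset.sum_congr rfl fun τ hτ => ?_
  rw [← sum_permsOn_mul_right (permsOn_mono h hτ)
    (fun ρ => (Equiv.Perm.sign ρ : ℤ) • F (w ∘ ρ))]
  refine Finset.sum_congr rfl fun ρ _ => ?_
  rw [smul_smul, Equiv.Perm.sign_mul, Units.val_mul]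
  rfl

theorem sum_altSum_comm {S T : Set (Fin ℓ)} (h : Disjoint S T) (F : (Fin ℓ → Fin m) → A)
    (w : Fin ℓ → Fin m) :
    ∑ σ ∈ permsOn S, (Equiv.Perm.sign σ : ℤ) • altSum T F (w ∘ σ) =
      ∑ τ ∈ permsOn T, (Equiv.Perm.sign τ : ℤ) • altSum S F (w ∘ τ) := by
  simp only [altSum, Finset.smul_sum]
  rw [Finset.sum_comm]
  refine Finset.sum_congr rfl fun τ hτ => Finset.sum_congr rfl fun σ hσ => ?_
  have hcomm : σ * τ = τ * σ := by
    refine Equiv.Perm.Disjoint.commute fun p => ?_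
    by_cases hp : p ∈ S
    · exact Or.inr (mem_permsOn.1 hτ p (Set.disjoint_left.1 h hp))
    · exact Or.inl (mem_permsOn.1 hσ p hp)
  have : (w ∘ σ) ∘ τ = (w ∘ τ) ∘ σ := by
    funext p
    exact congrArg w (DFunLike.congr_fun hcomm p)
  rw [smul_smul, smul_smul, this, mul_comm]

theorem eq_of_comp_eq_comp {S : Set (Fin ℓ)} {w : Fin ℓ → Fin m} (hw : Set.InjOn w S)
    {σ τ : Equiv.Perm (Fin ℓ)} (hσ : σ ∈ permsOn S) (hτ : τ ∈ permsOn S)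
    (h : w ∘ σ = w ∘ τ) : σ = τ := by
  ext p : 1
  by_cases hp : p ∈ S
  · exact hw (apply_mem_of_mem_permsOn hσ hp) (apply_mem_of_mem_permsOn hτ hp) (congrFun h p)
  · rw [mem_permsOn.1 hσ p hp, mem_permsOn.1 hτ p hp]

/-- Let `S ⊆ U`. If the alternating sums over `S` vanish for the other rearrangements of `w`
inside `U` that decrease on `S`, then the alternating sums of `w` over `U` and over `S`
coincide: the sum over `U` splits into cosets of the permutations of `S`, and only the trivial
coset contributes. -/
theorem altSum_eq_altSum_of_subset [IsAddTorsionFree A] {S U : Set (Fin ℓ)} (hSU : S ⊆ U)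
    {F : (Fin ℓ → Fin m) → A} {w : Fin ℓ → Fin m} (hw : Set.InjOn w U)
    (H : ∀ ρ ∈ permsOn U, StrictAntiOn (w ∘ ρ) S → w ∘ ρ ≠ w → altSum S F (w ∘ ρ) = 0) :
    altSum U F w = altSum S F w := by
  have h := sum_altSum_of_subset hSU F w
  have h2 : ∑ ρ ∈ permsOn U, (Equiv.Perm.sign ρ : ℤ) • altSum S F (w ∘ ρ) =
      (permsOn S).card • altSum S F w := by
    rw [← Finset.sum_const]
    symm
    refine Finset.sum_subset_zero_on_sdiff (permsOn_mono hSU) (fun ρ hρ => ?_) (fun ρ hρ => ?_)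
    · obtain ⟨hρU, hρS⟩ := Finset.mem_sdiff.1 hρ
      have hinj : Set.InjOn (w ∘ ρ) S := fun p hp q hq hpq =>
        ρ.injective (hw (apply_mem_of_mem_permsOn hρU (hSU hp))
          (apply_mem_of_mem_permsOn hρU (hSU hq)) hpq)
      obtain ⟨τ, hτ, hanti⟩ := exists_strictAntiOn_comp hinj
      have h0 := H (ρ * τ) (mul_mem_permsOn hρU (permsOn_mono hSU hτ)) hanti fun he => hρS <| by
        have := eq_of_comp_eq_comp hw (mul_mem_permsOn hρU (permsOn_mono hSU hτ))
          (one_mem_permsOn U) he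
        rw [eq_inv_of_mul_eq_one_left this]
        exact inv_mem_permsOn hτ
      change altSum S F ((w ∘ ρ) ∘ τ) = 0 at h0
      rw [altSum_comp hτ] at h0
      have h1 := congrArg (fun x => (Equiv.Perm.sign τ : ℤ) • x) h0
      simp only [smul_smul, sign_mul_self, one_smul, smul_zero] at h1
      rw [h1, smul_zero]
    · rw [altSum_comp hρ, smul_smul, sign_mul_self, one_smul]
  have hcard : (permsOn S).card ≠ 0 := Finset.card_ne_zero_of_mem (one_mem_permsOn S)
  exact nsmul_right_injective hcard (h.symm.trans h2)

/-- An alternating sum over a set of positions on which `w` repeats an entry vanishes. -/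
theorem altSum_eq_zero_of_not_injOn [IsAddTorsionFree A] {S : Set (Fin ℓ)}
    (F : (Fin ℓ → Fin m) → A) {w : Fin ℓ → Fin m} (hw : ¬ Set.InjOn w S) :
    altSum S F w = 0 := by
  simp only [Set.InjOn, not_forall] at hw
  obtain ⟨p, hp, q, hq, hpq, hne⟩ := hw
  have h := altSum_comp (swap_mem_permsOn hp hq) F w
  have hw : w ∘ Equiv.swap p q = w := by
    funext r
    simp only [Function.comp, Equiv.swap_apply_def]
    split_ifs with h1 h2
    · rw [h1, hpq]
    · rw [h2, hpq]
    · rfl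
  rw [hw, Equiv.Perm.sign_swap hne, Units.val_neg, Units.val_one, neg_smul, one_smul] at h
  exact self_eq_neg.1 h

end

/-! ### The recursion for the path counts and confluence -/

section

variable {k ℓ m : ℕ}

/-- A reversion path is either empty or ends with a reversion. -/
def ReversionPath.unsnoc {i j : Fin ℓ → Fin m} :
    ReversionPath k i j ≃
      PLift (i = j) ⊕ Σ j' : {j' // Reversion k j' j}, ReversionPath k i j'.1 where
  toFun
    | .nil => .inl ⟨rfl⟩
    | .snoc γ h => .inr ⟨⟨_, h⟩, γ⟩
  invFun
    | .inl ⟨rfl⟩ => .nil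
    | .inr ⟨⟨_, h⟩, γ⟩ => .snoc γ h
  left_inv γ := by cases γ <;> rfl
  right_inv
    | .inl ⟨rfl⟩ => rfl
    | .inr ⟨⟨_, _⟩, _⟩ => rfl

theorem neg_one_pow_sub_sub {a b n : ℕ} (h : a + n ≤ b) :
    (-1 : ℤ) ^ (b - a - n) = (-1) ^ (b + a + n) := by
  obtain ⟨d, rfl⟩ := Nat.exists_eq_add_of_le h
  rw [show a + n + d - a - n = d by omega, show a + n + d + a + n = d + 2 * (a + n) by ring,
    pow_add, pow_mul]
  simp

open Classical in
/-- Decomposing a path by its last reversion. -/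
theorem c_eq (i j : Fin ℓ → Fin m) :
    c k i j = (if i = j then 1 else 0) -
      ∑ j' : Fin ℓ → Fin m with Reversion k j' j, (-1) ^ (inv j + inv j') * c k i j' := by
  have h0 : c k i j = ∑ x : PLift (i = j) ⊕ Σ j' : {j' // Reversion k j' j},
      ReversionPath k i j'.1, (-1) ^ (inv j - inv i - (ReversionPath.unsnoc.symm x).length) :=
    Fintype.sum_equiv ReversionPath.unsnoc _ _ (by simp)
  rw [h0, Fintype.sum_sum_type, sub_eq_add_neg]
  congr 1
  · split_ifs with h
    · subst h
      rw [Fintype.sum_subsingleton _ ⟨rfl⟩]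
      change (-1 : ℤ) ^ (inv i - inv i - 0) = 1
      simp
    · have : IsEmpty (PLift (i = j)) := ⟨fun x => h x.down⟩
      simp
  · rw [Fintype.sum_sigma, ← Finset.sum_neg_distrib]
    rw [Finset.sum_subtype (p := fun j' => Reversion k j' j) _ (by simp)]
    refine Finset.sum_congr rfl fun j' _ => ?_
    rw [c, Finset.mul_sum, ← Finset.sum_neg_distrib]
    refine Finset.sum_congr rfl fun γ _ => ?_
    change (-1 : ℤ) ^ (inv j - inv i - (γ.length + 1)) = _
    have h1 := γ.inv_add_length_le
    have h2 := j'.2.inv_lt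
    rw [neg_one_pow_sub_sub h1, neg_one_pow_sub_sub (by omega), ← pow_add]
    rw [show inv j + inv j'.1 + (inv j'.1 + inv i + γ.length) =
      inv j + inv i + γ.length + 2 * inv j'.1 by ring, pow_add _ _ (2 * _), pow_mul, ← add_assoc,
      pow_succ]
    simp

theorem Admissible.not_isLeast {i : Fin ℓ → Fin m} (hi : Admissible k i) (s : ℕ) :
    ¬ IsLeast {s | DecreasingAt k i s} s := fun h => hi s h.1

theorem c_of_admissible {j : Fin ℓ → Fin m} (hj : Admissible k j) (i : Fin ℓ → Fin m) :
    c k i j = if i = j then 1 else 0 := by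
  classical
  rw [c_eq, Finset.filter_false_of_mem, Finset.sum_empty, sub_zero]
  rintro j' - ⟨-, s, hs, -⟩
  exact hj.not_isLeast s hs

theorem exists_isLeast_decreasingAt {j : Fin ℓ → Fin m} {s : ℕ} (hs : DecreasingAt k j s) :
    ∃ s₀, IsLeast {s | DecreasingAt k j s} s₀ ∧ s₀ ≤ s := by
  classical
  have h : ∃ s, DecreasingAt k j s := ⟨s, hs⟩
  exact ⟨Nat.find h, ⟨Nat.find_spec h, fun t ht => Nat.find_min' h ht⟩, Nat.find_min' h hs⟩

/-- The recursion for `c` says that its alternating sum over the leftmost decreasing run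
vanishes. -/
theorem altSum_c_leftmost {i j : Fin ℓ → Fin m} (hi : Admissible k i) {s : ℕ}
    (hs : IsLeast {s | DecreasingAt k j s} s) : altSum (window ℓ k s) (c k i) j = 0 := by
  classical
  have hij : i ≠ j := by
    rintro rfl
    exact hi s hs.1
  have hinj := hs.1.2.injOn
  rw [altSum, ← Finset.add_sum_erase _ _ (one_mem_permsOn _)]
  have h1 : ∑ j' : Fin ℓ → Fin m with Reversion k j' j, (-1) ^ (inv j + inv j') * c k i j' =
      ∑ σ ∈ (permsOn (window ℓ k s)).erase 1, (Equiv.Perm.sign σ : ℤ) • c k i (j ∘ σ) := by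
    symm
    refine Finset.sum_bij (fun σ _ => j ∘ σ) ?_ ?_ ?_ ?_
    · intro σ hσ
      obtain ⟨hne, hσ⟩ := Finset.mem_erase.1 hσ
      simp only [Finset.mem_filter, Finset.mem_univ, true_and]
      exact ⟨fun h => hne (eq_of_comp_eq_comp hinj hσ (one_mem_permsOn _) h), s, hs, σ,
        mem_permsOn.1 hσ, rfl⟩
    · intro σ hσ τ hτ h
      exact eq_of_comp_eq_comp hinj (Finset.mem_of_mem_erase hσ) (Finset.mem_of_mem_erase hτ) h
    · intro j' hj'
      simp only [Finset.mem_filter, Finset.mem_univ, true_and] at hj'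
      obtain ⟨hne, t, ht, σ, hσ, rfl⟩ := hj'
      rw [ht.unique hs] at hσ
      refine ⟨σ, Finset.mem_erase.2 ⟨?_, mem_permsOn.2 hσ⟩, rfl⟩
      rintro rfl
      exact hne rfl
    · intro σ hσ
      rw [pow_add, neg_one_pow_inv_comp (ordConnected_window ℓ k s) (Finset.mem_of_mem_erase hσ)
        hinj, mul_left_comm, ← pow_add, Even.neg_one_pow ⟨_, rfl⟩, mul_one, smul_eq_mul]
  rw [← h1]
  simp [c_eq i j, hij]

/-- Confluence: the alternating sum of `c k i` over any decreasing run of length `k`, not only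
the leftmost one, vanishes. -/
theorem altSum_c_of_decreasingAt {i : Fin ℓ → Fin m} (hi : Admissible k i) {j : Fin ℓ → Fin m}
    {s : ℕ} (hs : DecreasingAt k j s) : altSum (window ℓ k s) (c k i) j = 0 := by
  induction hn : inv j using Nat.strong_induction_on generalizing j s with
  | _ n ih =>
  subst hn
  obtain ⟨s₀, hs₀, hle⟩ := exists_isLeast_decreasingAt hs
  by_cases hlt : s < s₀ + k
  · -- Overlapping runs: both alternating sums equal the one over the union `U` of the runs.
    set U := window ℓ (s + k - s₀) s₀
    have hanti : StrictAntiOn j U := strictAntiOn_window_union hle hlt hs₀.1.2 hs.2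
    have key : ∀ t, s₀ ≤ t → t ≤ s → altSum U (c k i) j = altSum (window ℓ k t) (c k i) j := by
      intro t h1 h2
      refine altSum_eq_altSum_of_subset (window_subset h1 (by omega)) hanti.injOn ?_
      intro ρ hρ hdec hne
      refine ih _ ?_ ⟨by have := hs.1; omega, hdec⟩ rfl
      -- The rearrangement is a reversion for runs of length `|U|`, of which `U` is the leftmost.
      refine Reversion.inv_lt (k := s + k - s₀) ⟨hne, s₀, ⟨⟨?_, hanti⟩, ?_⟩, ρ,
        mem_permsOn.1 hρ, rfl⟩
      · have := hs.1
        omega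
      · intro t' ht'
        have := ht'.1
        exact hs₀.2 ⟨by omega, ht'.2.mono (window_subset le_rfl (by omega))⟩
    rw [← key s hle le_rfl, key s₀ le_rfl hle, altSum_c_leftmost hi hs₀]
  · -- Disjoint runs: the alternating sums commute.
    have hdisj : Disjoint (window ℓ k s) (window ℓ k s₀) := by
      rw [Set.disjoint_left]
      intro p hp hp'
      simp only [window, Set.mem_ofPred_eq] at hp hp'
      omega
    have hcomm := sum_altSum_comm hdisj (c k i) j
    have hcongr : ∀ (w w' : Fin ℓ → Fin m) (t : ℕ), (∀ p ∈ window ℓ k t, w p = w' p) →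
        DecreasingAt k w t → DecreasingAt k w' t := fun w w' t h hd =>
      ⟨hd.1, fun p hp q hq hpq => by rw [← h p hp, ← h q hq]; exact hd.2 hp hq hpq⟩
    rw [Finset.sum_eq_zero, ← Finset.add_sum_erase _ _ (one_mem_permsOn _),
      Finset.sum_eq_zero, add_zero] at hcomm
    · simpa using hcomm.symm
    · intro τ hτ
      obtain ⟨hne, hτ⟩ := Finset.mem_erase.1 hτ
      rw [ih _ _ _ rfl, smul_zero]
      · exact Reversion.inv_lt ⟨fun h => hne (eq_of_comp_eq_comp hs₀.1.2.injOn hτ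
          (one_mem_permsOn _) h), s₀, hs₀, τ, mem_permsOn.1 hτ, rfl⟩
      · refine hcongr _ _ _ (fun p hp => ?_) hs
        rw [Function.comp, mem_permsOn.1 hτ p (Set.disjoint_left.1 hdisj hp)]
    · intro σ hσ
      have hfix : ∀ t, t ≤ s₀ → ∀ p ∈ window ℓ k t, σ p = p := fun t ht p hp =>
        mem_permsOn.1 hσ p fun hp' => by
          simp only [window, Set.mem_ofPred_eq] at hp hp'
          omega
      rw [altSum_c_leftmost hi, smul_zero]
      refine ⟨hcongr _ _ _ (fun p hp => ?_) hs₀.1, fun t ht => ?_⟩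
      · rw [Function.comp, hfix s₀ le_rfl p hp]
      · by_contra hc
        exact hc (hs₀.2 (hcongr _ _ _ (fun p hp => by
          rw [Function.comp, hfix t (not_le.1 hc).le p hp]) ht))

/-- Confluence in general form: the path counts vanish on all relations. -/
theorem altSum_c {i : Fin ℓ → Fin m} (hi : Admissible k i) {s : ℕ} (hs : s + k ≤ ℓ)
    (j : Fin ℓ → Fin m) : altSum (window ℓ k s) (c k i) j = 0 := by
  by_cases hinj : Set.InjOn j (window ℓ k s)
  · obtain ⟨τ, hτ, hanti⟩ := exists_strictAntiOn_comp hinj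
    have h := altSum_c_of_decreasingAt hi ⟨hs, hanti⟩
    rw [altSum_comp hτ] at h
    simpa using h
  · exact altSum_eq_zero_of_not_injOn _ hinj

end

/-! ### The trace on the quotient of the tensor power -/

section

open Matrix

variable {S : Type*} [CommRing S] {m : ℕ}

/-- The `ℓ`-th tensor power of a matrix, with rows and columns indexed by sequences. -/
def tensorPow (ℓ : ℕ) (a : Matrix (Fin m) (Fin m) S) :
    Matrix (Fin ℓ → Fin m) (Fin ℓ → Fin m) S :=
  Matrix.of fun i j => ∏ s, a (i s) (j s)

theorem tensorPow_mul (ℓ : ℕ) (a b : Matrix (Fin m) (Fin m) S) :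
    tensorPow ℓ (a * b) = tensorPow ℓ a * tensorPow ℓ b := by
  ext i j
  simp only [tensorPow, Matrix.of_apply, Matrix.mul_apply, Finset.prod_univ_sum,
    Fintype.piFinset_univ, Finset.prod_mul_distrib]

open Classical in
/-- The matrix of the normal form map: its row `j` expresses the word `j` in terms of admissible
words, modulo the alternating sums over runs of length `k`. -/
noncomputable def normalForm (S : Type*) [CommRing S] (k ℓ m : ℕ) :
    Matrix (Fin ℓ → Fin m) (Fin ℓ → Fin m) S :=
  Matrix.of fun j i => if Admissible k i then ((c k i j : ℤ) : S) else 0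

open Classical in
/-- The sum of `c_{i,j} a_{ij}` over admissible `i` and arbitrary `j` of length `ℓ`, for a matrix
`a` with entries in any commutative ring. This is the trace of `a` on the degree `ℓ` part of the
quotient of the tensor algebra by the ideal generated by the `k`-th exterior power. -/
noncomputable def levelTrace (k ℓ : ℕ) (a : Matrix (Fin m) (Fin m) S) : S :=
  ∑ i : Fin ℓ → Fin m with Admissible k i, ∑ j : Fin ℓ → Fin m,
    (c k i j : ℤ) • ∏ s, a (i s) (j s)

theorem levelTrace_eq_trace (k ℓ : ℕ) (a : Matrix (Fin m) (Fin m) S) :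
    levelTrace k ℓ a = (tensorPow ℓ a * normalForm S k ℓ m).trace := by
  classical
  simp only [levelTrace, Matrix.trace, Matrix.diag, Matrix.mul_apply, tensorPow, normalForm,
    Matrix.of_apply, Finset.sum_filter]
  refine Finset.sum_congr rfl fun i _ => ?_
  split_ifs
  · simp only [zsmul_eq_mul, mul_comm]
  · simp

/-- A function on words that vanishes on the relations: all alternating sums over `k`
consecutive positions vanish. -/
def Alternating {ℓ : ℕ} (k : ℕ) (F : (Fin ℓ → Fin m) → S) : Prop :=
  ∀ s, s + k ≤ ℓ → ∀ w, altSum (window ℓ k s) F w = 0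

variable {k ℓ : ℕ}

/-- A function vanishing on the relations is determined by its values on admissible words. -/
theorem Alternating.ext {F G : (Fin ℓ → Fin m) → S} (hF : Alternating k F)
    (hG : Alternating k G) (h : ∀ j, Admissible k j → F j = G j) : F = G := by
  classical
  funext j
  induction hn : inv j using Nat.strong_induction_on generalizing j with
  | _ n ih =>
  subst hn
  by_cases hj : Admissible k j
  · exact h j hj
  · simp only [Admissible, not_forall, not_not] at hj
    obtain ⟨t, ht⟩ := hj
    obtain ⟨s, hs, -⟩ := exists_isLeast_decreasingAt ht
    have h1 := hF s hs.1.1 j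
    have h2 := hG s hs.1.1 j
    rw [altSum, ← Finset.add_sum_erase _ _ (one_mem_permsOn _)] at h1 h2
    rw [← h2] at h1
    have h3 : ∑ σ ∈ (permsOn (window ℓ k s)).erase 1, (Equiv.Perm.sign σ : ℤ) • F (j ∘ σ) =
        ∑ σ ∈ (permsOn (window ℓ k s)).erase 1, (Equiv.Perm.sign σ : ℤ) • G (j ∘ σ) := by
      refine Finset.sum_congr rfl fun σ hσ => ?_
      obtain ⟨hne, hσ⟩ := Finset.mem_erase.1 hσ
      rw [ih _ _ _ rfl]
      exact Reversion.inv_lt ⟨fun h => hne (eq_of_comp_eq_comp hs.1.2.injOn hσ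
        (one_mem_permsOn _) h), s, hs, σ, mem_permsOn.1 hσ, rfl⟩
    rw [h3, add_left_inj] at h1
    simpa using h1

/-- The relations are stable under tensor powers of matrices: these commute with permutations of
the positions. -/
theorem Alternating.tensorPow_mulVec {F : (Fin ℓ → Fin m) → S} (hF : Alternating k F)
    (a : Matrix (Fin m) (Fin m) S) : Alternating k (tensorPow ℓ a *ᵥ F) := by
  intro s hs w
  have h1 : ∀ σ : Equiv.Perm (Fin ℓ), (tensorPow ℓ a *ᵥ F) (w ∘ σ) =
      ∑ j, tensorPow ℓ a w j * F (j ∘ σ) := by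
    intro σ
    simp only [Matrix.mulVec, dotProduct]
    rw [← Equiv.sum_comp (Equiv.arrowCongr σ.symm (Equiv.refl (Fin m)))]
    refine Finset.sum_congr rfl fun j _ => ?_
    congr 1
    exact Equiv.prod_comp σ (fun p => a (w p) (j p))
  simp only [altSum, h1, Finset.smul_sum]
  rw [Finset.sum_comm]
  refine Finset.sum_eq_zero fun j _ => ?_
  have h2 := hF s hs j
  rw [altSum] at h2
  calc _ = tensorPow ℓ a w j *
          ∑ σ ∈ permsOn (window ℓ k s), (Equiv.Perm.sign σ : ℤ) • F (j ∘ σ) := by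
        rw [Finset.mul_sum]
        exact Finset.sum_congr rfl fun σ _ => (mul_smul_comm _ _ _).symm
    _ = 0 := by rw [h2, mul_zero]

theorem alternating_normalForm_col (i : Fin ℓ → Fin m) :
    Alternating k fun j => normalForm S k ℓ m j i := by
  intro s hs w
  simp only [altSum, normalForm, Matrix.of_apply]
  split_ifs with hi
  · have h := congrArg (Int.cast : ℤ → S) (altSum_c hi hs w)
    simpa [altSum] using h
  · simp

/-- A function vanishing on the relations factors through the normal form map. -/
theorem normalForm_mulVec {F : (Fin ℓ → Fin m) → S} (hF : Alternating k F) :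
    normalForm S k ℓ m *ᵥ F = F := by
  classical
  refine Alternating.ext (k := k) (fun s hs w => ?_) hF fun j hj => ?_
  · simp only [altSum, Matrix.mulVec, dotProduct, Finset.smul_sum]
    rw [Finset.sum_comm]
    refine Finset.sum_eq_zero fun i _ => ?_
    have h2 := alternating_normalForm_col (S := S) i s hs w
    rw [altSum] at h2
    rw [← zero_mul (F i), ← h2, Finset.sum_mul]
    exact Finset.sum_congr rfl fun σ _ => (smul_mul_assoc _ _ _).symm
  · simp only [Matrix.mulVec, dotProduct, normalForm, Matrix.of_apply]
    rw [Finset.sum_eq_single j]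
    · simp [hj, c_of_admissible hj]
    · intro i _ hij
      simp [c_of_admissible hj, hij]
    · simp

/-- The kernel of the normal form map is stable under tensor powers. -/
theorem normalForm_mul_tensorPow_mul_normalForm (a : Matrix (Fin m) (Fin m) S) :
    normalForm S k ℓ m * (tensorPow ℓ a * normalForm S k ℓ m) =
      tensorPow ℓ a * normalForm S k ℓ m := by
  ext j i
  have h := normalForm_mulVec ((alternating_normalForm_col (S := S) (k := k) i).tensorPow_mulVec a)
  exact congrFun h j

/-- This gives the invariance of `levelTrace` under conjugation. -/
theorem levelTrace_mul_comm (a b : Matrix (Fin m) (Fin m) S) :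
    levelTrace k ℓ (a * b) = levelTrace k ℓ (b * a) := by
  have key : ∀ a b : Matrix (Fin m) (Fin m) S, levelTrace k ℓ (a * b) =
      ((tensorPow ℓ a * normalForm S k ℓ m) * (tensorPow ℓ b * normalForm S k ℓ m)).trace := by
    intro a b
    rw [levelTrace_eq_trace, tensorPow_mul, Matrix.mul_assoc, Matrix.mul_assoc,
      normalForm_mul_tensorPow_mul_normalForm]
  rw [key, key, Matrix.trace_mul_comm]

theorem levelTrace_map {S' : Type*} [CommRing S'] (f : S →+* S')
    (a : Matrix (Fin m) (Fin m) S) : levelTrace k ℓ (a.map f) = f (levelTrace k ℓ a) := by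
  simp [levelTrace, map_sum, map_prod]

/-- Reversions preserve the sum of the entries. -/
theorem c_eq_zero_of_sum_ne {i j : Fin ℓ → Fin m}
    (h : ∑ s, (i s : ℕ) ≠ ∑ s, (j s : ℕ)) : c k i j = 0 := by
  have hpath : ∀ {j : Fin ℓ → Fin m}, ReversionPath k i j →
      ∑ s, (i s : ℕ) = ∑ s, (j s : ℕ) := by
    intro j γ
    induction γ with
    | nil => rfl
    | @snoc j j' γ h ih =>
      obtain ⟨-, s, -, σ, -, rfl⟩ := h
      exact ih.trans (Equiv.sum_comp σ fun s => (j' s : ℕ))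
  have : IsEmpty (ReversionPath k i j) := ⟨fun γ => h (hpath γ)⟩
  simp [c]

open Classical in
/-- For a lower triangular matrix only the diagonal terms `c_{i,i} a_{ii}` survive: `a_{ij} ≠ 0`
forces `j ≤ i` entrywise, and `c_{i,j} ≠ 0` forces `i` and `j` to have the same sum. -/
theorem levelTrace_of_lowerTriangular {a : Matrix (Fin m) (Fin m) S}
    (ha : ∀ p q, p < q → a p q = 0) :
    levelTrace k ℓ a = ∑ i : Fin ℓ → Fin m with Admissible k i, ∏ s, a (i s) (i s) := by
  refine Finset.sum_congr rfl fun i hi => ?_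
  have hi : Admissible k i := (Finset.mem_filter.1 hi).2
  rw [Finset.sum_eq_single i]
  · rw [c_of_admissible hi, if_pos rfl, one_smul]
  · intro j _ hij
    by_cases hle : ∀ s, j s ≤ i s
    · have hlt : ∑ s, (j s : ℕ) < ∑ s, (i s : ℕ) := by
        refine Finset.sum_lt_sum (fun s _ => Fin.le_def.1 (hle s)) ?_
        obtain ⟨s, hs⟩ := Function.ne_iff.1 hij
        exact ⟨s, Finset.mem_univ s, Fin.lt_def.1 (lt_of_le_of_ne (hle s) hs)⟩
      rw [c_eq_zero_of_sum_ne hlt.ne', zero_smul]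
    · push Not at hle
      obtain ⟨s, hs⟩ := hle
      rw [Finset.prod_eq_zero (Finset.mem_univ s) (ha _ _ hs), smul_zero]
  · simp

end

/-! ### Triangularization -/

open Module in
/-- Over an algebraically closed field, every endomorphism is lower triangular in some basis: the
range of `f - μ`, for an eigenvalue `μ`, lies in a hyperplane, which is then invariant. -/
theorem exists_basis_lowerTriangular {K : Type*} [Field K] [IsAlgClosed K] (n : ℕ) :
    ∀ {V : Type*} [AddCommGroup V] [Module K V] [FiniteDimensional K V],
      finrank K V = n → ∀ f : End K V,
      ∃ b : Basis (Fin n) K V, ∀ p q, p < q → b.repr (f (b q)) p = 0 := by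
  induction n with
  | zero =>
    intro V _ _ _ hV f
    exact ⟨finBasisOfFinrankEq K V hV, fun p => p.elim0⟩
  | succ n ih =>
    intro V _ _ _ hV f
    have : Nontrivial V := nontrivial_of_finrank_pos (R := K) (by omega)
    obtain ⟨μ, hμ⟩ := End.exists_eigenvalue f
    have hlt : LinearMap.range (f - algebraMap K (End K V) μ) < ⊤ := by
      rw [lt_top_iff_ne_top]
      intro htop
      refine hμ ?_
      change End.eigenspace f μ = ⊥
      rw [End.eigenspace_def]
      exact LinearMap.ker_eq_bot_iff_range_eq_top.2 htop
    obtain ⟨φ, hφ, hle⟩ := Submodule.exists_le_ker_of_lt_top _ hlt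
    have hinv : ∀ x ∈ LinearMap.ker φ, f x ∈ LinearMap.ker φ := by
      intro x hx
      have h1 : (f - algebraMap K (End K V) μ) x ∈ LinearMap.ker φ := hle ⟨x, rfl⟩
      have h2 : f x = (f - algebraMap K (End K V) μ) x + μ • x := by simp
      rw [h2]
      exact add_mem h1 (Submodule.smul_mem _ _ hx)
    have hfin : finrank K (LinearMap.ker φ) = n := by
      have := Module.Dual.finrank_ker_add_one_of_ne_zero hφ
      omega
    obtain ⟨b, hb⟩ := ih hfin (f.restrict hinv)
    obtain ⟨y, hy⟩ : ∃ y, φ y ≠ 0 := by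
      by_contra! hc
      exact hφ (LinearMap.ext hc)
    let B : Basis (Fin (n + 1)) K V := Basis.mkFinCons y b
      (fun c x hx h => by
        have h1 : φ (c • y + x) = 0 := by rw [h, map_zero]
        rw [map_add, LinearMap.mem_ker.1 hx, add_zero, map_smul, smul_eq_mul] at h1
        exact (mul_eq_zero.1 h1).resolve_right hy)
      (fun z => ⟨-(φ z / φ y), by simp [LinearMap.mem_ker, hy]⟩)
    have hBs : ∀ q : Fin n, B q.succ = b q := fun q => by simp [B, Basis.coe_mkFinCons]
    have hrepr : ∀ x : LinearMap.ker φ, B.repr x 0 = 0 ∧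
        ∀ p : Fin n, B.repr x p.succ = b.repr x p := by
      intro x
      have hx : (x : V) = ∑ q, b.repr x q • B q.succ := by
        have h := congrArg (LinearMap.ker φ).subtype (b.sum_repr x)
        rw [map_sum] at h
        simpa [hBs] using h.symm
      rw [hx]
      constructor
      · simp
      · intro p
        simp [Finsupp.single_apply]
    refine ⟨B, fun p q hpq => ?_⟩
    obtain ⟨q, rfl⟩ := Fin.exists_succ_eq.2 (Fin.ne_zero_of_lt hpq)
    have h1 : f (B q.succ) = (f.restrict hinv (b q) : LinearMap.ker φ) := by rw [hBs]; rfl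
    rw [h1]
    rcases Fin.eq_zero_or_eq_succ p with rfl | ⟨p, rfl⟩
    · exact (hrepr _).1
    · rw [(hrepr _).2]
      exact hb p q (Fin.succ_lt_succ_iff.1 hpq)

/-- Over an algebraically closed field, every square matrix is similar to a lower triangular
one. -/
theorem exists_similar_lowerTriangular {K : Type*} [Field K] [IsAlgClosed K] {m : ℕ}
    (a : Matrix (Fin m) (Fin m) K) : ∃ g h t : Matrix (Fin m) (Fin m) K,
      g * h = 1 ∧ a = g * t * h ∧ ∀ p q, p < q → t p q = 0 := by
  obtain ⟨b, hb⟩ := exists_basis_lowerTriangular m (by simp) (Matrix.toLin' a)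
  let e := Pi.basisFun K (Fin m)
  refine ⟨e.toMatrix b, b.toMatrix e, LinearMap.toMatrix b b (Matrix.toLin' a), ?_, ?_, ?_⟩
  · exact e.toMatrix_mul_toMatrix_flip b
  · rw [basis_toMatrix_mul_linearMap_toMatrix_mul_basis_toMatrix]
    exact (LinearMap.toMatrix'_toLin' a).symm
  · intro p q hpq
    rw [LinearMap.toMatrix_apply]
    exact hb p q hpq

/-! ### Splitting words into an admissible prefix and a decreasing suffix -/

/-- The sign of the `r`-th exterior power in the inverse series: `1` if `r ≡ 0`, `-1` if `r ≡ 1`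
modulo `k`, and `0` otherwise. -/
def koszulSign (k r : ℕ) : ℤ := if r % k = 0 then 1 else if r % k = 1 then -1 else 0

theorem sum_range_koszulSign {k D : ℕ} (hD : 1 ≤ D) (hDk : D < k) :
    ∑ r ∈ Finset.range (D + 1), koszulSign k r = 0 := by
  induction D, hD using Nat.le_induction with
  | base =>
    simp [Finset.sum_range_succ, koszulSign, Nat.mod_eq_of_lt hDk]
  | succ D hD ih =>
    rw [Finset.sum_range_succ, ih (by omega), koszulSign, Nat.mod_eq_of_lt hDk, if_neg (by omega),
      if_neg (by omega), add_zero]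

theorem sum_Ico_koszulSign {k : ℕ} (hk : 2 ≤ k) (a : ℕ) :
    ∑ r ∈ Finset.Ico a (a + k), koszulSign k r = 0 := by
  induction a with
  | zero =>
    have h := sum_range_koszulSign (k := k) (D := k - 1) (by omega) (by omega)
    rw [show k - 1 + 1 = k by omega, Finset.range_eq_Ico] at h
    simpa using h
  | succ a ih =>
    have h1 : koszulSign k (a + k) = koszulSign k a := by simp [koszulSign]
    rw [Finset.sum_eq_sum_Ico_succ_bot (by omega)] at ih
    rw [show a + 1 + k = a + k + 1 by omega, Finset.sum_Ico_succ_top (by omega), h1, add_comm, ih]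

section

variable {n m : ℕ}

/-- The first `L` entries of `w` contain no decreasing run of length `k`. -/
def PrefixAdmissible (k : ℕ) (w : Fin n → Fin m) (L : ℕ) : Prop :=
  ∀ s, s + k ≤ L → ¬ StrictAntiOn w (window n k s)

/-- The entries of `w` from position `L` on are strictly decreasing. -/
def SuffixDecreasing (w : Fin n → Fin m) (L : ℕ) : Prop := StrictAntiOn w (window n n L)

open Classical in
/-- For a fixed nonempty word, the splittings into an admissible prefix and a decreasing suffix
cancel. If the whole word is admissible, the suffix lengths form an interval from `0` to some
`D` with `1 ≤ D < k`; otherwise, they form an interval of `k` integers or are absent. -/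
theorem sum_splittings_eq_zero {k : ℕ} (hk : 2 ≤ k) (hn : n ≠ 0) (w : Fin n → Fin m) :
    ∑ L ∈ Finset.range (n + 1),
      (if PrefixAdmissible k w L ∧ SuffixDecreasing w L then koszulSign k (n - L) else 0) = 0 := by
  have hSn : SuffixDecreasing w n := by
    intro p hp
    exact absurd hp.1 (by omega)
  have hSmono : ∀ L L', L ≤ L' → SuffixDecreasing w L → SuffixDecreasing w L' := by
    intro L L' h hL p hp q hq
    exact hL ⟨h.trans hp.1, by omega⟩ ⟨h.trans hq.1, by omega⟩
  have hPmono : ∀ L L', L ≤ L' → PrefixAdmissible k w L' → PrefixAdmissible k w L :=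
    fun L L' h hL s hs => hL s (hs.trans h)
  have hP0 : PrefixAdmissible k w 0 := fun s hs => by omega
  have hS : ∃ L, SuffixDecreasing w L := ⟨n, hSn⟩
  -- The splitting points are the integers in the interval from `a` to `b`.
  obtain ⟨a, haS, hamin⟩ : ∃ a, SuffixDecreasing w a ∧ ∀ L, SuffixDecreasing w L → a ≤ L :=
    ⟨Nat.find hS, Nat.find_spec hS, fun L hL => Nat.find_min' hS hL⟩
  obtain ⟨b, hbn, hbP, hbmax⟩ : ∃ b ≤ n, PrefixAdmissible k w b ∧
      ∀ L ≤ n, PrefixAdmissible k w L → L ≤ b :=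
    ⟨Nat.findGreatest (PrefixAdmissible k w) n, Nat.findGreatest_le n,
      Nat.findGreatest_spec (Nat.zero_le n) hP0, fun L hL h => Nat.le_findGreatest hL h⟩
  have han : a ≤ n := hamin n hSn
  have hsum : ∑ L ∈ Finset.range (n + 1),
      (if PrefixAdmissible k w L ∧ SuffixDecreasing w L then koszulSign k (n - L) else 0) =
      ∑ r ∈ Finset.Ico (n - b) (n - a + 1), koszulSign k r := by
    rw [← Finset.sum_filter]
    refine Finset.sum_bij' (fun L _ => n - L) (fun r _ => n - r) ?_ ?_ ?_ ?_ ?_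
    · intro L hL
      obtain ⟨hL, hP, hS⟩ := Finset.mem_filter.1 hL
      have h1 := Finset.mem_range.1 hL
      have h2 := hamin L hS
      have h3 := hbmax L (by omega) hP
      rw [Finset.mem_Ico]
      omega
    · intro r hr
      rw [Finset.mem_Ico] at hr
      rw [Finset.mem_filter, Finset.mem_range]
      exact ⟨by omega, hPmono _ b (by omega) hbP, hSmono a _ (by omega) haS⟩
    · intro L hL
      have := Finset.mem_range.1 (Finset.mem_filter.1 hL).1
      omega
    · intro r hr
      rw [Finset.mem_Ico] at hr
      omega
    · intro L hL
      rfl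
  rw [hsum]
  rcases hbn.eq_or_lt with rfl | hbn
  · rw [Nat.sub_self, ← Finset.range_eq_Ico]
    refine sum_range_koszulSign ?_ ?_
    · have : a ≤ b - 1 := hamin _ fun p hp q hq hpq => by
        have h1 : (p : ℕ) < q := hpq
        have h2 := hp.1
        omega
      omega
    · by_contra hc
      exact hbP (b - k) (by omega) (haS.mono (window_subset (by omega) (by omega)))
  · have hb1 : ¬ PrefixAdmissible k w (b + 1) := fun h => by
      have := hbmax (b + 1) (by omega) h
      omega
    simp only [PrefixAdmissible, not_forall, not_not] at hb1
    obtain ⟨s, hs, hanti⟩ := hb1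
    have hsb : s + k = b + 1 := by
      by_contra hc
      exact hbP s (by omega) hanti
    by_cases hab : a ≤ b
    · have h1 : a ≤ s := by
        by_contra hc
        have h := strictAntiOn_window_union (by omega : s ≤ a) (by omega) hanti haS
        have := hamin s (h.mono fun p hp => ⟨hp.1, by omega⟩)
        omega
      have h2 : s ≤ a := by
        by_contra hc
        exact hbP (s - 1) (by omega) (haS.mono fun p hp => ⟨by have := hp.1; omega, by omega⟩)
      rw [show n - a + 1 = n - b + k by omega]
      exact sum_Ico_koszulSign hk _
    · rw [Finset.Ico_eq_empty (by omega), Finset.sum_empty]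

variable {S : Type*} [CommRing S]

open Classical in
/-- The generating function of admissible words. -/
noncomputable def admissibleSum (k ℓ : ℕ) (t : Fin m → S) : S :=
  ∑ i : Fin ℓ → Fin m with Admissible k i, ∏ s, t (i s)

open Classical in
/-- The elementary symmetric polynomial, as a sum over decreasing words. -/
noncomputable def decreasingSum (r : ℕ) (t : Fin m → S) : S :=
  ∑ d : Fin r → Fin m with StrictAnti d, ∏ s, t (d s)

theorem prefixAdmissible_append {k ℓ r : ℕ} (i : Fin ℓ → Fin m) (d : Fin r → Fin m) :
    PrefixAdmissible k (Fin.append i d) ℓ ↔ Admissible k i := by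
  have key : ∀ s, s + k ≤ ℓ → (StrictAntiOn (Fin.append i d) (window (ℓ + r) k s) ↔
      StrictAntiOn i (window ℓ k s)) := by
    intro s hs
    constructor
    · intro h p hp q hq hpq
      have := h (a := Fin.castAdd r p) hp (b := Fin.castAdd r q) hq hpq
      simpa using this
    · intro h p hp q hq hpq
      obtain ⟨p, rfl⟩ : ∃ p', Fin.castAdd r p' = p := ⟨⟨p, by have := hp.2; omega⟩, rfl⟩
      obtain ⟨q, rfl⟩ : ∃ q', Fin.castAdd r q' = q := ⟨⟨q, by have := hq.2; omega⟩, rfl⟩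
      simp only [Fin.append_left]
      exact h hp hq hpq
  constructor
  · exact fun h s hs => h s hs.1 ((key s hs.1).2 hs.2)
  · exact fun h s hs hd => h s ⟨hs, (key s hs).1 hd⟩

theorem suffixDecreasing_append {ℓ r : ℕ} (i : Fin ℓ → Fin m) (d : Fin r → Fin m) :
    SuffixDecreasing (Fin.append i d) ℓ ↔ StrictAnti d := by
  constructor
  · intro h p q hpq
    have := h (a := Fin.natAdd ℓ p) ⟨by simp, by have := p.2; simp; omega⟩
      (b := Fin.natAdd ℓ q) ⟨by simp, by have := q.2; simp; omega⟩
      ((Fin.natAdd_lt_natAdd_iff ℓ).2 hpq)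
    simpa using this
  · intro h p hp q hq hpq
    obtain ⟨p, rfl⟩ : ∃ p', Fin.natAdd ℓ p' = p :=
      ⟨⟨p - ℓ, by have := p.2; have := hp.1; omega⟩, Fin.ext (by have := hp.1; simp; omega)⟩
    obtain ⟨q, rfl⟩ : ∃ q', Fin.natAdd ℓ q' = q :=
      ⟨⟨q - ℓ, by have := q.2; have := hq.1; omega⟩, Fin.ext (by have := hq.1; simp; omega)⟩
    simp only [Fin.append_right]
    exact h ((Fin.natAdd_lt_natAdd_iff ℓ).1 hpq)

open Classical in
theorem admissibleSum_mul_decreasingSum {k ℓ r : ℕ} (h : ℓ + r = n) (t : Fin m → S) :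
    admissibleSum k ℓ t * decreasingSum r t =
      ∑ w : Fin n → Fin m,
        if PrefixAdmissible k w ℓ ∧ SuffixDecreasing w ℓ then ∏ p, t (w p) else 0 := by
  subst h
  rw [admissibleSum, decreasingSum, Finset.sum_mul_sum, ← Finset.sum_product',
    ← Finset.filter_product, Finset.sum_filter]
  refine Fintype.sum_equiv (Fin.appendEquiv ℓ r) _ _ fun x => ?_
  simp only [Fin.appendEquiv_apply, Fin.prod_univ_add, Fin.append_left, Fin.append_right]
  exact if_congr (and_congr (prefixAdmissible_append _ _) (suffixDecreasing_append _ _)).symm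
    rfl rfl

theorem sum_antidiagonal_admissibleSum_mul_decreasingSum {k : ℕ} (hk : 2 ≤ k) (hn : n ≠ 0)
    (t : Fin m → S) :
    ∑ x ∈ Finset.HasAntidiagonal.antidiagonal n,
      admissibleSum k x.1 t * ((koszulSign k x.2 : S) * decreasingSum x.2 t) = 0 := by
  classical
  rw [Finset.Nat.sum_antidiagonal_eq_sum_range_succ_mk]
  have h1 : ∀ L ∈ Finset.range n.succ,
      admissibleSum k L t * ((koszulSign k (n - L) : S) * decreasingSum (n - L) t) =
      ∑ w : Fin n → Fin m, ((if PrefixAdmissible k w L ∧ SuffixDecreasing w L then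
        koszulSign k (n - L) else 0 : ℤ) : S) * ∏ p, t (w p) := by
    intro L hL
    have hL := Finset.mem_range.1 hL
    rw [mul_left_comm, admissibleSum_mul_decreasingSum (show L + (n - L) = n by omega),
      Finset.mul_sum]
    refine Finset.sum_congr rfl fun w _ => ?_
    split_ifs <;> simp
  rw [Finset.sum_congr rfl h1, Finset.sum_comm]
  refine Finset.sum_eq_zero fun w _ => ?_
  rw [← Finset.sum_mul, ← Int.cast_sum, sum_splittings_eq_zero hk hn, Int.cast_zero, zero_mul]

theorem decreasingSum_eq_sum_powersetCard (r : ℕ) (t : Fin m → S) :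
    decreasingSum r t = ∑ J ∈ Finset.univ.powersetCard r, ∏ j ∈ J, t j := by
  classical
  refine Finset.sum_bij (fun d _ => Finset.univ.image d) ?_ ?_ ?_ ?_
  · intro d hd
    have hd : StrictAnti d := (Finset.mem_filter.1 hd).2
    rw [Finset.mem_powersetCard]
    exact ⟨Finset.subset_univ _, by rw [Finset.card_image_of_injective _ hd.injective]; simp⟩
  · intro d hd d' hd' h
    have hd : StrictAnti d := (Finset.mem_filter.1 hd).2
    have hd' : StrictAnti d' := (Finset.mem_filter.1 hd').2
    have h1 : Set.range d = Set.range d' := by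
      have := congrArg (fun J : Finset (Fin m) => (J : Set (Fin m))) h
      simpa using this
    exact (hd.range_inj hd').1 h1
  · intro J hJ
    have hJ := (Finset.mem_powersetCard.1 hJ).2
    refine ⟨J.orderEmbOfFin hJ ∘ Fin.rev, Finset.mem_filter.2 ⟨Finset.mem_univ _,
      (J.orderEmbOfFin hJ).strictMono.comp_strictAnti Fin.rev_strictAnti⟩, ?_⟩
    rw [← Finset.coe_inj, Finset.coe_image, Finset.coe_univ, Set.image_univ,
      Fin.rev_surjective.range_comp, Finset.range_orderEmbOfFin]
  · intro d hd
    have hd : StrictAnti d := (Finset.mem_filter.1 hd).2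
    rw [Finset.prod_image fun _ _ _ _ h => hd.injective h]

end

/-! ### Sums of principal minors -/

section

variable {S : Type*} [CommRing S] {m : ℕ}

/-- The sum of the principal `r × r` minors of `a`, that is, the trace of `a` on the `r`-th
exterior power. -/
def minorSum (r : ℕ) (a : Matrix (Fin m) (Fin m) S) : S :=
  ∑ J ∈ Finset.univ.powersetCard r, (a.submatrix (Subtype.val : J → Fin m) Subtype.val).det

theorem minorSum_map {S' : Type*} [CommRing S'] (f : S →+* S') (r : ℕ)
    (a : Matrix (Fin m) (Fin m) S) : minorSum r (a.map f) = f (minorSum r a) := by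
  rw [minorSum, minorSum, map_sum]
  refine Finset.sum_congr rfl fun J _ => ?_
  rw [RingHom.map_det]
  rfl

theorem minorSum_zero (a : Matrix (Fin m) (Fin m) S) : minorSum 0 a = 1 := by
  simp [minorSum]

theorem minorSum_of_lt {r : ℕ} (h : m < r) (a : Matrix (Fin m) (Fin m) S) :
    minorSum r a = 0 := by
  rw [minorSum, Finset.powersetCard_eq_empty.2 (by simpa using h), Finset.sum_empty]

theorem minorSum_mul_comm (r : ℕ) (a b : Matrix (Fin m) (Fin m) S) :
    minorSum r (a * b) = minorSum r (b * a) := by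
  have key : ∀ a b : Matrix (Fin m) (Fin m) S,
      1 + (Polynomial.X : Polynomial S) • (a * b).map Polynomial.C =
        1 + ((Polynomial.X : Polynomial S) • a.map Polynomial.C) * b.map Polynomial.C := by
    intro a b
    rw [Matrix.map_mul, smul_mul_assoc]
  rw [minorSum, minorSum, ← Matrix.coeff_det_one_add_X_smul_eq_sum_minors,
    ← Matrix.coeff_det_one_add_X_smul_eq_sum_minors, key, Matrix.det_one_add_mul_comm, key,
    mul_smul_comm, smul_mul_assoc]

theorem minorSum_of_lowerTriangular (r : ℕ) {a : Matrix (Fin m) (Fin m) S}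
    (ha : ∀ p q, p < q → a p q = 0) :
    minorSum r a = decreasingSum r fun p => a p p := by
  rw [decreasingSum_eq_sum_powersetCard]
  refine Finset.sum_congr rfl fun J _ => ?_
  rw [← Finset.prod_coe_sort]
  exact Matrix.det_of_isLowerTriangular _ fun p q h => ha _ _ h

/-- The sign of a partial permutation is the parity of its number of inversions. -/
theorem PartialPerm.neg_one_pow_inv (ω : PartialPerm m) :
    (-1 : ℤ) ^ ω.inv = Equiv.Perm.sign ω.2 := by
  obtain ⟨J, ω⟩ := ω
  let e := J.orderIsoOfFin rfl
  let σ : Equiv.Perm (Fin J.card) := e.symm.toEquiv.permCongr ω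
  have h1 := neg_one_pow_inv_comp (S := Set.univ) Set.ordConnected_univ (σ := σ)
    (mem_permsOn.2 fun p hp => absurd (Set.mem_univ p) hp) (Set.injOn_id _)
  have h2 : KReversion.inv (id : Fin J.card → Fin J.card) = 0 := by
    simp only [KReversion.inv, Finset.card_eq_zero, Finset.filter_eq_empty_iff]
    rintro p - ⟨h, h'⟩
    exact lt_asymm h h'
  have h3 : KReversion.inv (id ∘ σ) = PartialPerm.inv ⟨J, ω⟩ := by
    refine Finset.card_equiv (Equiv.prodCongr e.toEquiv e.toEquiv) fun p => ?_
    simp [σ, Equiv.permCongr_apply]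
  rw [h2, h3, pow_zero, mul_one, Equiv.Perm.sign_permCongr] at h1
  exact h1

theorem minorSum_eq_sum_partialPerm (r : ℕ) (a : Matrix (Fin m) (Fin m) S) :
    minorSum r a = ∑ ω : PartialPerm m with ω.1.card = r,
      (-1) ^ ω.inv * ∏ j : ω.1, a j (ω.2 j) := by
  have h1 : ∀ ω : PartialPerm m, (-1 : S) ^ ω.inv = ((Equiv.Perm.sign ω.2 : ℤ) : S) := by
    intro ω
    rw [← ω.neg_one_pow_inv]
    simp
  rw [minorSum, ← Finset.univ_sigma_univ, Finset.sum_filter, Finset.sum_sigma]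
  rw [show Finset.univ.powersetCard r = Finset.univ.filter fun J : Finset (Fin m) => J.card = r by
    ext J; simp [Finset.mem_powersetCard], Finset.sum_filter]
  refine Finset.sum_congr rfl fun J _ => ?_
  split_ifs with hJ
  · rw [← Matrix.det_transpose, Matrix.det_apply']
    exact Finset.sum_congr rfl fun ω _ => by rw [h1]; rfl
  · simp

end

/-! ### The identity in each degree -/

section

variable {m k : ℕ}

/-- The component of degree `n` of the product of the two series. -/
noncomputable def convolution {S : Type*} [CommRing S] (k n : ℕ) (a : Matrix (Fin m) (Fin m) S) :
    S :=
  ∑ x ∈ Finset.HasAntidiagonal.antidiagonal n,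
    levelTrace k x.1 a * ((koszulSign k x.2 : S) * minorSum x.2 a)

theorem convolution_map {S S' : Type*} [CommRing S] [CommRing S'] (f : S →+* S') (n : ℕ)
    (a : Matrix (Fin m) (Fin m) S) : convolution k n (a.map f) = f (convolution k n a) := by
  simp [convolution, levelTrace_map, minorSum_map]

theorem convolution_eq_zero_of_isAlgClosed {K : Type*} [Field K] [IsAlgClosed K] (hk : 2 ≤ k)
    {n : ℕ} (hn : n ≠ 0) (a : Matrix (Fin m) (Fin m) K) : convolution k n a = 0 := by
  obtain ⟨g, h, t, hgh, rfl, ht⟩ := exists_similar_lowerTriangular a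
  have hhg : h * g = 1 := mul_eq_one_comm.1 hgh
  rw [← sum_antidiagonal_admissibleSum_mul_decreasingSum hk hn fun p => t p p, convolution]
  refine Finset.sum_congr rfl fun x _ => ?_
  rw [levelTrace_mul_comm, minorSum_mul_comm, ← mul_assoc h g t, hhg, one_mul,
    levelTrace_of_lowerTriangular ht, minorSum_of_lowerTriangular _ ht, admissibleSum]

/-- The matrix of variables. -/
noncomputable def genericMatrix (S : Type*) [CommRing S] (m : ℕ) :
    Matrix (Fin m) (Fin m) (MvPolynomial (Fin m × Fin m) S) :=
  Matrix.of fun p q => MvPolynomial.X (p, q)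

/-- By the principle of permanence of identities, it suffices to consider complex matrices. -/
theorem convolution_eq_zero {S : Type*} [CommRing S] (hk : 2 ≤ k) {n : ℕ} (hn : n ≠ 0)
    (a : Matrix (Fin m) (Fin m) S) : convolution k n a = 0 := by
  have hC : convolution k n (genericMatrix ℂ m) = 0 := by
    refine MvPolynomial.funext fun x => ?_
    rw [← convolution_map, convolution_eq_zero_of_isAlgClosed hk hn, map_zero]
  have hZ : convolution k n (genericMatrix ℤ m) = 0 := by
    refine MvPolynomial.map_injective (Int.castRingHom ℂ) Int.cast_injective ?_
    rw [map_zero, ← convolution_map, ← hC]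
    congr 1
    ext1 p q
    simp [genericMatrix]
  have ha : a = (genericMatrix ℤ m).map
      (MvPolynomial.eval₂Hom (Int.castRingHom S) fun x => a x.1 x.2) := by
    ext p q
    simp [genericMatrix]
  rw [ha, convolution_map, hZ, map_zero]

theorem levelTrace_zero {S : Type*} [CommRing S] (hk : k ≠ 0) (a : Matrix (Fin m) (Fin m) S) :
    levelTrace k 0 a = 1 := by
  have hadm : ∀ i : Fin 0 → Fin m, Admissible k i := fun i s hs => by
    have := hs.1
    omega
  simp [levelTrace, hadm, c_of_admissible]

theorem convolution_zero {S : Type*} [CommRing S] (hk : k ≠ 0) (a : Matrix (Fin m) (Fin m) S) :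
    convolution k 0 a = 1 := by
  simp [convolution, levelTrace_zero hk, minorSum_zero, koszulSign]

end

/-! ### Homogeneity and convergence -/

section

variable {m k : ℕ} {R : Type*} [CommRing R]

theorem isHomogeneous_levelTrace (ℓ : ℕ) :
    (levelTrace k ℓ (genericMatrix R m)).IsHomogeneous ℓ := by
  refine MvPolynomial.IsHomogeneous.sum _ _ _ fun i _ =>
    MvPolynomial.IsHomogeneous.sum _ _ _ fun j _ => ?_
  rw [zsmul_eq_mul, ← map_intCast (MvPolynomial.C : R →+* MvPolynomial (Fin m × Fin m) R)]
  refine MvPolynomial.IsHomogeneous.C_mul ?_ _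
  simpa using MvPolynomial.IsHomogeneous.prod Finset.univ
    (fun s => genericMatrix R m (i s) (j s)) (fun _ => 1)
    (fun s _ => MvPolynomial.isHomogeneous_X R (i s, j s))

theorem isHomogeneous_minorSum (r : ℕ) : (minorSum r (genericMatrix R m)).IsHomogeneous r := by
  rw [minorSum_eq_sum_partialPerm]
  refine MvPolynomial.IsHomogeneous.sum _ _ _ fun ω hω => ?_
  rw [show (-1 : MvPolynomial (Fin m × Fin m) R) ^ ω.inv = MvPolynomial.C ((-1) ^ ω.inv) by simp]
  refine MvPolynomial.IsHomogeneous.C_mul ?_ _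
  have h : ω.1.card = r := (Finset.mem_filter.1 hω).2
  simpa [h] using MvPolynomial.IsHomogeneous.prod Finset.univ
    (fun j : ω.1 => genericMatrix R m j (ω.2 j)) (fun _ => 1)
    (fun j _ => MvPolynomial.isHomogeneous_X R ((j : Fin m), (ω.2 j : Fin m)))

theorem levelSum_eq_coe (ℓ : ℕ) :
    levelSum R m k ℓ = (levelTrace k ℓ (genericMatrix R m) : MvPolynomial (Fin m × Fin m) R) := by
  have h := levelTrace_map (k := k) (ℓ := ℓ)
    (MvPolynomial.coeToMvPowerSeries.ringHom (σ := Fin m × Fin m) (R := R)) (genericMatrix R m)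
  rw [MvPolynomial.coeToMvPowerSeries.ringHom_apply] at h
  rw [← h]
  simp [levelSum, levelTrace, aSeq, genericMatrix]

theorem coeff_levelSum_of_ne {d : Fin m × Fin m →₀ ℕ} {ℓ : ℕ} (h : d.degree ≠ ℓ) :
    MvPowerSeries.coeff d (levelSum R m k ℓ) = 0 := by
  rw [levelSum_eq_coe, MvPolynomial.coeff_coe]
  exact (isHomogeneous_levelTrace ℓ).coeff_eq_zero h

theorem bracket_eq_coe (hk : 2 ≤ k) :
    (∑ r ∈ (Finset.range (m + 1)).filter (fun r => r ≡ 0 [MOD k] ∨ r ≡ 1 [MOD k]),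
        (-1) ^ α k r * ∑ ω : PartialPerm m with ω.1.card = r, (-1) ^ (r + ω.inv) * aPerm R ω) =
      ((∑ r ∈ Finset.range (m + 1), (koszulSign k r : MvPolynomial (Fin m × Fin m) R) *
        minorSum r (genericMatrix R m) : MvPolynomial (Fin m × Fin m) R) :
        MvPowerSeries (Fin m × Fin m) R) := by
  rw [← MvPolynomial.coeToMvPowerSeries.ringHom_apply, map_sum, Finset.sum_filter]
  refine Finset.sum_congr rfl fun r _ => ?_
  have h1 : ∑ ω : PartialPerm m with ω.1.card = r,
      (-1 : MvPowerSeries (Fin m × Fin m) R) ^ (r + ω.inv) * aPerm R ω =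
      (-1) ^ r * MvPolynomial.coeToMvPowerSeries.ringHom (minorSum r (genericMatrix R m)) := by
    rw [minorSum_eq_sum_partialPerm, map_sum, Finset.mul_sum]
    refine Finset.sum_congr rfl fun ω _ => ?_
    rw [map_mul, map_pow, map_neg, map_one, map_prod, pow_add, mul_assoc]
    simp [aPerm, genericMatrix]
  have h2 : r % k ≤ r := Nat.mod_le r k
  have h3 : (-1 : MvPowerSeries (Fin m × Fin m) R) ^ α k r * (-1) ^ r = (-1) ^ (r % k) := by
    rw [← pow_add, α, show r - r % k + r = r % k + 2 * (r - r % k) by omega, pow_add, pow_mul]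
    simp
  rw [h1, ← mul_assoc, h3, map_mul, map_intCast]
  simp only [Nat.ModEq, Nat.zero_mod, Nat.mod_eq_of_lt (show 1 < k by omega), koszulSign]
  by_cases h0 : r % k = 0
  · simp [h0]
  · by_cases h1 : r % k = 1 <;> simp [h0, h1]

/-- The product is computed coefficientwise, since multiplication need not be continuous for an
arbitrary topology on `R`. Each coefficient of degree `n` is one of `convolution k n`. -/
theorem mul_bracket_eq_one (hk : 2 ≤ k) {G : MvPowerSeries (Fin m × Fin m) R}
    (hG : ∀ d, MvPowerSeries.coeff d G = MvPowerSeries.coeff d (levelSum R m k d.degree)) :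
    G * (∑ r ∈ (Finset.range (m + 1)).filter (fun r => r ≡ 0 [MOD k] ∨ r ≡ 1 [MOD k]),
        (-1) ^ α k r *
          ∑ ω : PartialPerm m with ω.1.card = r, (-1) ^ (r + ω.inv) * aPerm R ω) = 1 := by
  classical
  rw [bracket_eq_coe hk]
  set A := genericMatrix R m
  have hE : ∀ (e : Fin m × Fin m →₀ ℕ) (r : ℕ), e.degree ≠ r → MvPolynomial.coeff e
      ((koszulSign k r : MvPolynomial (Fin m × Fin m) R) * minorSum r A) = 0 := by
    intro e r h
    rw [← map_intCast (MvPolynomial.C : R →+* MvPolynomial (Fin m × Fin m) R),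
      MvPolynomial.coeff_C_mul, (isHomogeneous_minorSum r).coeff_eq_zero h, mul_zero]
  have hE' : ∀ e : Fin m × Fin m →₀ ℕ, MvPolynomial.coeff e
      (∑ r ∈ Finset.range (m + 1), (koszulSign k r : MvPolynomial (Fin m × Fin m) R) *
        minorSum r A) = MvPolynomial.coeff e
      ((koszulSign k e.degree : MvPolynomial (Fin m × Fin m) R) * minorSum e.degree A) := by
    intro e
    rw [MvPolynomial.coeff_sum]
    refine Finset.sum_eq_single _ (fun r _ hr => hE e r hr.symm) fun h => ?_
    rw [minorSum_of_lt (by simpa using h), mul_zero, MvPolynomial.coeff_zero]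
  ext d
  have hconv : convolution k d.degree A = if d.degree = 0 then 1 else 0 := by
    split_ifs with h
    · rw [h, convolution_zero (by omega)]
    · exact convolution_eq_zero hk h A
  have hd := congrArg (MvPolynomial.coeff d) hconv
  rw [convolution, MvPolynomial.coeff_sum] at hd
  rw [Finset.sum_congr rfl fun x _ => MvPolynomial.coeff_mul _ _ d, Finset.sum_comm] at hd
  rw [MvPowerSeries.coeff_mul]
  calc _ = _ := by
        refine Finset.sum_congr rfl fun x hx => ?_
        have hx : x.1 + x.2 = d := Finset.HasAntidiagonal.mem_antidiagonal.1 hx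
        rw [hG, levelSum_eq_coe, MvPolynomial.coeff_coe, MvPolynomial.coeff_coe, hE']
        symm
        refine Finset.sum_eq_single (x.1.degree, x.2.degree) (fun y _ hy => ?_) fun h => ?_
        · by_cases h1 : x.1.degree = y.1
          · rw [hE _ _ fun h2 => hy (Prod.ext h1.symm h2.symm), mul_zero]
          · rw [(isHomogeneous_levelTrace y.1).coeff_eq_zero h1, zero_mul]
        · exact absurd (Finset.HasAntidiagonal.mem_antidiagonal.2 (by rw [← hx, map_add])) h
    _ = _ := hd
    _ = _ := by
        rw [MvPowerSeries.coeff_one]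
        simp only [Finsupp.degree_eq_zero_iff]
        split_ifs with h
        · rw [h, MvPolynomial.coeff_zero_one]
        · rw [MvPolynomial.coeff_zero]

end

end KReversion


theorem corollary3 (R : Type*) [CommRing R] [TopologicalSpace R] [T2Space R]
    (m k : ℕ) (hk : 2 ≤ k) (hkm : k ≤ m) :
    Summable (fun ℓ : ℕ => KReversion.levelSum R m k (ℓ + 1)) ∧
    (1 + ∑' ℓ : ℕ, KReversion.levelSum R m k (ℓ + 1)) *
      (∑ r ∈ (Finset.range (m + 1)).filter (fun r => r ≡ 0 [MOD k] ∨ r ≡ 1 [MOD k]),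
        (-1) ^ KReversion.α k r *
          ∑ ω : KReversion.PartialPerm m with ω.1.card = r,
            (-1) ^ (r + ω.inv) * KReversion.aPerm R ω) = 1 := by
  classical
  -- By homogeneity, at most one term contributes to each coefficient of the infinite sum.
  let G : MvPowerSeries (Fin m × Fin m) R := fun d =>
    if d.degree = 0 then 0 else MvPowerSeries.coeff d (KReversion.levelSum R m k d.degree)
  have hsum : HasSum (fun ℓ : ℕ => KReversion.levelSum R m k (ℓ + 1)) G := by
    rw [MvPowerSeries.WithPiTopology.hasSum_iff_hasSum_coeff]
    intro d
    have hGd : MvPowerSeries.coeff d G = if d.degree = 0 then 0 else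
      MvPowerSeries.coeff d (KReversion.levelSum R m k d.degree) := rfl
    rw [hGd]
    split_ifs with hd
    · convert! hasSum_zero using 2 with ℓ
      exact KReversion.coeff_levelSum_of_ne (by omega)
    · have h := hasSum_single (f := fun ℓ : ℕ =>
        MvPowerSeries.coeff d (KReversion.levelSum R m k (ℓ + 1))) (d.degree - 1)
        fun ℓ hℓ => KReversion.coeff_levelSum_of_ne (by omega)
      rwa [Nat.sub_add_cancel (by omega)] at h
  refine ⟨hsum.summable, KReversion.mul_bracket_eq_one hk fun d => ?_⟩
  rw [hsum.tsum_eq, map_add, MvPowerSeries.coeff_one]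
  change _ + (if d.degree = 0 then 0 else
    MvPowerSeries.coeff d (KReversion.levelSum R m k d.degree)) = _
  by_cases hd : d.degree = 0
  · have hd' : d = 0 := (Finsupp.degree_eq_zero_iff d).1 hd
    subst hd'
    rw [if_pos rfl, if_pos hd, hd, add_zero, KReversion.levelSum_eq_coe,
      KReversion.levelTrace_zero (by omega), MvPolynomial.coe_one, MvPowerSeries.coeff_zero_one]
  · rw [if_neg hd, if_neg fun h => hd (by rw [h, map_zero]), zero_add]
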